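/- Conventions. For $\lambda$ in the open unit disc $\mathbb D$ put $b_\lambda(z)=\frac{z-\lambda}{1-\overline{\lambda}z}$. $H^\infty$ is the algebra of bounded holomorphic functions on $\mathbb D$. For a completely non-unitary contraction $T$ on a complex Hilbert space and $u\in H^\infty$, $u(T)$ denotes the Sz.-Nagy--Foias functional calculus, $u(T)=\lim_{r\to1^-}u(rT)$ in the strong operator topology. Such a $T$ is of class $C_0$ if $u(T)=0$ for some nonzero $u\in H^\infty$; an inner function $\theta$ is the minimal function of $T$ (unique up to a unimodular constant) if $\{u\in H^\infty: u(T)=0\}=\theta H^\infty$. $T$ is multiplicity-free if it has a cyclic vector, i.e. a vector $x$ such that the closed linear span of $\{T^nx:n\ge0\}$ is the whole space. **Theorem.** Let $N\ge 2$ and $\lambda_1,\dots,\lambda_N\in\mathbb D$ (not necessarily distinct), and let $T_1\in B(\mathcal H_1)$, $T_2\in B(\mathcal H_2)$ be multiplicity-free operators of class $C_0$ on complex Hilbert spaces, both with minimal function $\theta=b_{\lambda_1}\cdots b_{\lambda_N}$. Put $\psi_N=\theta/b_{\lambda_N}=b_{\lambda_1}\cdots b_{\lambda_{N-1}}$ and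 $$\eta=\sup_{1\le j,k\le N}\frac{|b_{\lambda_j}(\lambda_k)|^{1/2}}{(1-\max\{|\lambda_j|,|\lambda_k|\}^2)^{1/2}}.$$ Assume that $$\|\psi_N(T_1)\|>\beta_1+5\sqrt2\,\eta\quad\text{and}\quad\|\psi_N(T_2)\|>\beta_2+5\sqrt2\,\eta$$ for some constants $\beta_1,\beta_2$ satisfying $\sqrt{1-\frac1{(N-1)^2}}<\beta_i<1$ for $i=1,2$. Then there exists an invertible bounded linear operator $X:\mathcal H_1\to\mathcal H_2$ (with bounded inverse) such that $XT_1=T_2X$ and $$\max\{\|X\|,\|X^{-1}\|\}\le C(\beta_1,\beta_2,N),$$ where $C(\beta_1,\beta_2,N)>0$ depends only on $\beta_1,\beta_2$ and $N$; explicitly, one may take $$C(\beta_1,\beta_2,N)=\max_{i=1,2}\left(\frac{\beta_i^2}{N}\Bigl(1-(N-1)\sqrt{1-\beta_i^2}\Bigr)\right)^{-1/2}.$$ -/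

import Mathlib

open Filter Topology

noncomputable section

namespace ClassC0

/-- `u ∈ H^∞`: `u` is holomorphic and bounded on the open unit disc.  Only the values of `u` on
the disc matter; two functions that agree there represent the same element of `H^∞`. -/
def IsHInfty (u : ℂ → ℂ) : Prop :=
  DifferentiableOn ℂ u (Metric.ball 0 1) ∧ ∃ C : ℝ, ∀ z ∈ Metric.ball (0 : ℂ) 1, ‖u z‖ ≤ C

/-- An inner function: an element of `H^∞` whose radial boundary values have modulus one at
almost every point of the unit circle. -/
def IsInner (u : ℂ → ℂ) : Prop :=
  IsHInfty u ∧ ∀ᵐ t : ℝ,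
    Tendsto (fun r : ℝ => ‖u ((r : ℂ) * Complex.exp ((t : ℂ) * Complex.I))‖) (𝓝[<] 1) (𝓝 1)

/-- The Blaschke factor `b_a(z) = (z - a) / (1 - conj a * z)`. -/
def blaschkeFactor (a z : ℂ) : ℂ :=
  (z - a) / (1 - (starRingEnd ℂ) a * z)

/-- The finite Blaschke product `b_{a_1} ⋯ b_{a_N}`. -/
def blaschkeProduct {N : ℕ} (a : Fin N → ℂ) (z : ℂ) : ℂ :=
  ∏ k, blaschkeFactor (a k) z

/-- The quotient `ψ_j = θ / b_{a_j}` of the Blaschke product `θ = b_{a_1} ⋯ b_{a_N}`, that is, the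
product of the remaining factors (so that `ψ_j` also has its correct value at `a_j`). -/
def blaschkeQuotient {N : ℕ} (a : Fin N → ℂ) (j : Fin N) (z : ℂ) : ℂ :=
  ∏ k ∈ Finset.univ.erase j, blaschkeFactor (a k) z

/-- `η = sup_{j,k} |b_{a_j}(a_k)|^{1/2} / (1 - max(|a_j|, |a_k|)^2)^{1/2}`. -/
def eta {N : ℕ} (a : Fin N → ℂ) : ℝ :=
  ⨆ p : Fin N × Fin N,
    √‖blaschkeFactor (a p.1) (a p.2)‖ / √(1 - max ‖a p.1‖ ‖a p.2‖ ^ 2)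

section Operators

variable {H : Type*} [NormedAddCommGroup H] [InnerProductSpace ℂ H] [CompleteSpace H]

/-- A contraction `T` is completely non-unitary if `0` is the only closed subspace which reduces
`T` and on which `T` acts as a unitary operator. -/
def IsCompletelyNonUnitary (T : H →L[ℂ] H) : Prop :=
  ∀ M : Submodule ℂ H, IsClosed (M : Set H) →
    (∀ x ∈ M, T x ∈ M ∧ ContinuousLinearMap.adjoint T x ∈ M) →
    (∀ x ∈ M, ContinuousLinearMap.adjoint T (T x) = x ∧ T (ContinuousLinearMap.adjoint T x) = x) →
    M = ⊥

/-- `u(rT) = ∑ aₙ rⁿ Tⁿ`, where `u(z) = ∑ aₙ zⁿ` on the unit disc.  For `u ∈ H^∞`, `‖T‖ ≤ 1` and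
`0 ≤ r < 1` the series converges absolutely in operator norm. -/
def dilatedValue (T : H →L[ℂ] H) (u : ℂ → ℂ) (r : ℝ) : H →L[ℂ] H :=
  ∑' n : ℕ, (iteratedDeriv n u 0 / (n.factorial : ℂ) * (r : ℂ) ^ n) • T ^ n

/-- `A = u(T)` in the Sz.-Nagy--Foias functional calculus: `A` is the limit of `u(rT)` in the strong
operator topology as `r` increases to `1`.  For a completely non-unitary contraction `T` and
`u ∈ H^∞` this limit exists. -/
def IsFunctionalCalculusValue (T : H →L[ℂ] H) (u : ℂ → ℂ) (A : H →L[ℂ] H) : Prop :=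
  ∀ x : H, Tendsto (fun r : ℝ => dilatedValue T u r x) (𝓝[<] 1) (𝓝 (A x))

theorem IsFunctionalCalculusValue.unique {T : H →L[ℂ] H} {u : ℂ → ℂ} {A B : H →L[ℂ] H}
    (hA : IsFunctionalCalculusValue T u A) (hB : IsFunctionalCalculusValue T u B) : A = B :=
  ContinuousLinearMap.ext fun x => tendsto_nhds_unique (hA x) (hB x)

open Classical in
/-- The operator `u(T)` of the Sz.-Nagy--Foias functional calculus (and `0` in case the defining
limit does not exist, which happens for no completely non-unitary contraction and
`u ∈ H^∞`). -/
def functionalCalculus (T : H →L[ℂ] H) (u : ℂ → ℂ) : H →L[ℂ] H :=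
  if h : ∃ A, IsFunctionalCalculusValue T u A then h.choose else 0

theorem IsFunctionalCalculusValue.functionalCalculus_eq {T : H →L[ℂ] H} {u : ℂ → ℂ}
    {A : H →L[ℂ] H} (hA : IsFunctionalCalculusValue T u A) : functionalCalculus T u = A := by
  have h : ∃ A, IsFunctionalCalculusValue T u A := ⟨A, hA⟩
  rw [functionalCalculus, dif_pos h]
  exact h.choose_spec.unique hA

/-- `T` is of class `C_0`: a completely non-unitary contraction whose `H^∞` functional calculus has
a non-trivial kernel. -/
def IsClassC0 (T : H →L[ℂ] H) : Prop :=
  ‖T‖ ≤ 1 ∧ IsCompletelyNonUnitary T ∧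
    ∃ u : ℂ → ℂ, IsHInfty u ∧ (∃ z ∈ Metric.ball (0 : ℂ) 1, u z ≠ 0) ∧
      IsFunctionalCalculusValue T u 0

/-- `θ` is a minimal function of `T`: an inner function such that the kernel of the `H^∞` functional
calculus of `T` is `θ H^∞`. -/
def IsMinimalFunction (T : H →L[ℂ] H) (θ : ℂ → ℂ) : Prop :=
  IsInner θ ∧ ∀ u : ℂ → ℂ, IsHInfty u →
    (IsFunctionalCalculusValue T u 0 ↔
      ∃ f : ℂ → ℂ, IsHInfty f ∧ ∀ z ∈ Metric.ball (0 : ℂ) 1, u z = θ z * f z)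

/-- `x` is cyclic for `T`: the vectors `Tⁿ x`, `n ≥ 0`, span a dense subspace. -/
def IsCyclicVector (T : H →L[ℂ] H) (x : H) : Prop :=
  (Submodule.span ℂ (Set.range fun n : ℕ => (T ^ n) x)).topologicalClosure = ⊤

/-- `T` is multiplicity-free: it has a cyclic vector. -/
def IsMultiplicityFree (T : H →L[ℂ] H) : Prop :=
  ∃ x : H, IsCyclicVector T x

end Operators

/-- `(β² / N * (1 - (N - 1) * √(1 - β²)))^{-1/2}`. -/
def boundFactor (β : ℝ) (N : ℕ) : ℝ :=
  (√(β ^ 2 / N * (1 - ((N : ℝ) - 1) * √(1 - β ^ 2))))⁻¹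

/-- The constant `C(β₁, β₂, N)`. -/
def similarityConstant (β₁ β₂ : ℝ) (N : ℕ) : ℝ :=
  max (boundFactor β₁ N) (boundFactor β₂ N)

end ClassC0

end

/-!
Both operators act on spaces of dimension `N`, and each has a basis in which it is described by the
same rule: if `‖x‖ ≤ 1`, `ψ_N(T)` almost attains its norm at `x`, and
`e_k = (b_{a_1} ⋯ b_{a_k})(T) x` for `0 ≤ k < N`, with `e_N = θ(T) x = 0`, then
`(1 - conj a_{k+1} T) e_{k+1} = (T - a_{k+1}) e_k`.  The operator `X` matching the two bases
therefore intertwines `T₁` and `T₂`, and only the Gram matrices of the bases have to be controlled.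

All `e_k` have norm between `‖ψ_N(T) x‖` and `1`.  For `j < k` the contraction
`A = (b_{a_{j+1}} ⋯ b_{a_{N-1}})(T)` sends `e_j` to `ψ_N(T) x`, so it nearly preserves the norm of
`e_j`.  On the other hand `y = (b_{a_{j+2}} ⋯ b_{a_{N-1}})(T) e_k` is annihilated by `b_{a_N}(T)`,
since `θ(T) = 0`; it is an eigenvector of `T` for `a_N` (or zero), and
`A e_k = b_{a_{j+1}}(a_N) y` has norm at most `η² ‖e_k‖`.  As `1 - A* A` is small on `e_j`, the two
vectors are almost orthogonal (`norm_inner_le_of_contraction`, `norm_inner_map_prod_range_le`), and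
a Gershgorin estimate (`sum_sq_le_norm_sum_sq`) gives the lower bound for the Gram matrix, hence
linear independence.  Cyclicity and `θ(T) = 0` bound the dimension by `N`
(`finrank_le_of_wienerEval_prod_eq_zero`); all of this is collected in
`exists_almost_orthogonal_basis`.

Finite Blaschke products have absolutely summable Taylor coefficients, so their functional calculus
is the evaluation homomorphism `wienerEval` of the Wiener algebra, a commutative algebra in which
the products above can be manipulated freely.
-/

namespace ClassC0

/-! ### The Wiener algebra and its evaluation at contractions -/

theorem summable_norm_coeff_mul {p q : PowerSeries ℂ}
    (hp : Summable fun n => ‖PowerSeries.coeff n p‖)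
    (hq : Summable fun n => ‖PowerSeries.coeff n q‖) :
    Summable fun n => ‖PowerSeries.coeff n (p * q)‖ := by
  simp only [PowerSeries.coeff_mul]
  exact summable_norm_sum_mul_antidiagonal_of_summable_norm (f := fun n => PowerSeries.coeff n p)
    (g := fun n => PowerSeries.coeff n q) hp hq

theorem summable_norm_coeff_add {p q : PowerSeries ℂ}
    (hp : Summable fun n => ‖PowerSeries.coeff n p‖)
    (hq : Summable fun n => ‖PowerSeries.coeff n q‖) :
    Summable fun n => ‖PowerSeries.coeff n (p + q)‖ := by
  simp only [map_add]
  exact Summable.of_nonneg_of_le (fun _ => norm_nonneg _) (fun _ => norm_add_le _ _) (hp.add hq)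

theorem summable_norm_coeff_algebraMap (c : ℂ) :
    Summable fun n => ‖PowerSeries.coeff n (algebraMap ℂ (PowerSeries ℂ) c)‖ := by
  refine summable_of_ne_finset_zero (s := {0}) fun n hn => ?_
  simp only [Finset.mem_singleton] at hn
  simp [PowerSeries.coeff_C, hn]

/-- The Wiener algebra: complex power series with absolutely summable coefficients.  It is
commutative, and it acts on every contraction. -/
noncomputable def wienerAlgebra : Subalgebra ℂ (PowerSeries ℂ) where
  carrier := {p | Summable fun n => ‖PowerSeries.coeff n p‖}
  mul_mem' hp hq := summable_norm_coeff_mul hp hq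
  add_mem' hp hq := summable_norm_coeff_add hp hq
  algebraMap_mem' := summable_norm_coeff_algebraMap

section Eval

variable {A : Type*} [NormedRing A] [NormOneClass A] [NormedAlgebra ℂ A]

theorem summable_norm_coeff_smul_pow {t : A} (ht : ‖t‖ ≤ 1) (p : wienerAlgebra) :
    Summable fun n => ‖PowerSeries.coeff n (p : PowerSeries ℂ) • t ^ n‖ := by
  refine Summable.of_nonneg_of_le (fun _ => norm_nonneg _) (fun n => ?_) p.2
  rw [norm_smul]
  exact mul_le_of_le_one_right (norm_nonneg _)
    ((norm_pow_le t n).trans (pow_le_one₀ (norm_nonneg _) ht))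

variable [CompleteSpace A]

/-- Evaluation `p ↦ ∑ pₙ tⁿ` of the Wiener algebra at an element `t` of norm at most one of a
complex Banach algebra. -/
noncomputable def wienerEval (t : A) (ht : ‖t‖ ≤ 1) : wienerAlgebra →ₐ[ℂ] A where
  toFun p := ∑' n, PowerSeries.coeff n (p : PowerSeries ℂ) • t ^ n
  map_one' := by
    rw [tsum_eq_single 0 fun n hn => by simp [PowerSeries.coeff_one, hn]]
    simp
  map_mul' p q := by
    rw [tsum_mul_tsum_eq_tsum_sum_antidiagonal_of_summable_norm
      (summable_norm_coeff_smul_pow ht p) (summable_norm_coeff_smul_pow ht q)]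
    refine tsum_congr fun n => ?_
    simp only [MulMemClass.coe_mul, PowerSeries.coeff_mul, Finset.sum_smul]
    refine Finset.sum_congr rfl fun ij hij => ?_
    rw [smul_mul_smul_comm, ← pow_add, Finset.HasAntidiagonal.mem_antidiagonal.1 hij]
  map_zero' := by simp
  map_add' p q := by
    rw [← (summable_norm_coeff_smul_pow ht p).of_norm.tsum_add
      (summable_norm_coeff_smul_pow ht q).of_norm]
    exact tsum_congr fun n => by simp [add_smul]
  commutes' c := by
    rw [tsum_eq_single 0 fun n hn => by
      simp [PowerSeries.coeff_C, hn]]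
    simp [Algebra.algebraMap_eq_smul_one]

theorem wienerEval_apply {t : A} (ht : ‖t‖ ≤ 1) (p : wienerAlgebra) :
    wienerEval t ht p = ∑' n, PowerSeries.coeff n (p : PowerSeries ℂ) • t ^ n := rfl

/-- The coordinate function `z`, as an element of the Wiener algebra. -/
noncomputable def wienerX : wienerAlgebra :=
  ⟨PowerSeries.X, summable_of_ne_finset_zero (s := {1}) fun n hn => by
    simp only [Finset.mem_singleton] at hn
    simp [PowerSeries.coeff_X, hn]⟩

@[simp]
theorem wienerEval_X {t : A} (ht : ‖t‖ ≤ 1) : wienerEval t ht wienerX = t := by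
  rw [wienerEval_apply, tsum_eq_single 1 fun n hn => by simp [wienerX, PowerSeries.coeff_X, hn]]
  simp [wienerX]

end Eval

/-- The geometric series `∑ cⁿ zⁿ` for `|c| < 1`, as an element of the Wiener algebra. -/
noncomputable def wienerGeom (c : ℂ) (hc : ‖c‖ < 1) : wienerAlgebra :=
  ⟨PowerSeries.mk fun n => c ^ n, by
    change Summable _
    simpa [PowerSeries.coeff_mk] using summable_geometric_of_lt_one (norm_nonneg c) hc⟩

theorem one_sub_mul_wienerGeom (c : ℂ) (hc : ‖c‖ < 1) :
    (1 - algebraMap ℂ wienerAlgebra c * wienerX) * wienerGeom c hc = 1 := by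
  ext n
  simp only [wienerGeom, wienerX, sub_mul, one_mul, AddSubgroupClass.coe_sub, MulMemClass.coe_mul,
    Subalgebra.coe_algebraMap, PowerSeries.algebraMap_apply, Algebra.algebraMap_self_apply,
    mul_assoc, map_sub, PowerSeries.coeff_C_mul, OneMemClass.coe_one]
  cases n with
  | zero => simp
  | succ n => simp [PowerSeries.coeff_succ_X_mul, PowerSeries.coeff_one, pow_succ']

/-- The Blaschke factor `b_a`, as an element of the Wiener algebra. -/
noncomputable def wienerBlaschke (a : ℂ) (ha : ‖a‖ < 1) : wienerAlgebra :=
  (wienerX - algebraMap ℂ _ a) *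
    wienerGeom ((starRingEnd ℂ) a) (by rwa [RCLike.norm_conj])

theorem one_sub_mul_wienerBlaschke (a : ℂ) (ha : ‖a‖ < 1) :
    (1 - algebraMap ℂ _ ((starRingEnd ℂ) a) * wienerX) * wienerBlaschke a ha =
      wienerX - algebraMap ℂ _ a := by
  rw [wienerBlaschke, mul_left_comm, one_sub_mul_wienerGeom, mul_one]

theorem one_sub_conj_mul_ne_zero {a z : ℂ} (ha : ‖a‖ < 1) (hz : ‖z‖ ≤ 1) :
    1 - (starRingEnd ℂ) a * z ≠ 0 := by
  intro h
  have h1 : ‖(starRingEnd ℂ) a * z‖ = 1 := by rw [← sub_eq_zero.1 h, norm_one]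
  rw [norm_mul, RCLike.norm_conj] at h1
  nlinarith [norm_nonneg a, norm_nonneg z]

theorem wienerEval_wienerBlaschke {a z : ℂ} (ha : ‖a‖ < 1) (hz : ‖z‖ ≤ 1) :
    wienerEval z hz (wienerBlaschke a ha) = blaschkeFactor a z := by
  have h := congrArg (wienerEval z hz) (one_sub_mul_wienerBlaschke a ha)
  simp only [map_mul, map_sub, map_one, wienerEval_X, AlgHom.commutes,
    Algebra.algebraMap_self_apply] at h
  rw [blaschkeFactor, eq_div_iff (one_sub_conj_mul_ne_zero ha hz), mul_comm, h]

/-! ### The functional calculus on the Wiener algebra -/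

theorem iteratedDeriv_div_factorial_eq_coeff {u : ℂ → ℂ} {p : wienerAlgebra}
    (hu : ∀ z (hz : ‖z‖ < 1), u z = wienerEval z hz.le p) (n : ℕ) :
    iteratedDeriv n u 0 / (n.factorial : ℂ) = PowerSeries.coeff n (p : PowerSeries ℂ) := by
  set q := FormalMultilinearSeries.ofScalars ℂ
    fun n => PowerSeries.coeff n (p : PowerSeries ℂ) with hq
  have hnorm : ∀ n, ‖q n‖ = ‖PowerSeries.coeff n (p : PowerSeries ℂ)‖ := fun n =>
    FormalMultilinearSeries.ofScalars_norm _ _ n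
  have hball : HasFPowerSeriesOnBall u q 0 1 := by
    refine ⟨?_, one_pos, ?_⟩
    · have := q.le_radius_of_summable_norm (r := 1) (by
        simp only [hnorm, NNReal.coe_one, one_pow, mul_one]
        exact p.2)
      simpa using this
    · intro y hy
      have hy' : ‖y‖ < 1 := by
        rwa [Metric.mem_eball, edist_zero_right, enorm_eq_nnnorm, ENNReal.coe_lt_one_iff] at hy
      rw [zero_add, hu y hy', wienerEval_apply]
      have := (summable_norm_coeff_smul_pow hy'.le p).of_norm.hasSum
      simpa [hq, FormalMultilinearSeries.ofScalars_apply_eq, mul_comm] using this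
  have h := hball.hasFPowerSeriesAt.eq_formalMultilinearSeries
    hball.analyticAt.hasFPowerSeriesAt
  have h2 := congrArg (fun r : FormalMultilinearSeries ℂ ℂ ℂ => r.coeff n) h
  simpa [hq, FormalMultilinearSeries.coeff_ofScalars] using h2.symm

/-- For a function with absolutely summable Taylor coefficients, the functional calculus of a
contraction is the sum of the Taylor series. -/
theorem isFunctionalCalculusValue_wienerEval {H : Type*} [NormedAddCommGroup H]
    [InnerProductSpace ℂ H] [CompleteSpace H] [Nontrivial H] {T : H →L[ℂ] H} (hT : ‖T‖ ≤ 1)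
    {u : ℂ → ℂ} {p : wienerAlgebra} (hu : ∀ z (hz : ‖z‖ < 1), u z = wienerEval z hz.le p) :
    IsFunctionalCalculusValue T u (wienerEval T hT p) := by
  have key : Tendsto (fun r : ℝ => dilatedValue T u r) (𝓝[<] 1) (𝓝 (wienerEval T hT p)) := by
    unfold dilatedValue
    simp only [wienerEval_apply, iteratedDeriv_div_factorial_eq_coeff hu]
    refine tendsto_tsum_of_dominated_convergence p.2 (fun n => ?_) ?_
    · have hc : Continuous fun r : ℝ =>
          (PowerSeries.coeff n (p : PowerSeries ℂ) * (r : ℂ) ^ n) • T ^ n := by fun_prop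
      simpa using (hc.tendsto 1).mono_left nhdsWithin_le_nhds
    · have h0 : ∀ᶠ r : ℝ in 𝓝[<] 1, r ∈ Set.Ioo (0 : ℝ) 1 := Ioo_mem_nhdsLT one_pos
      filter_upwards [h0] with r hr n
      rw [norm_smul, norm_mul, norm_pow, Complex.norm_real, Real.norm_of_nonneg hr.1.le, mul_assoc]
      exact mul_le_of_le_one_right (norm_nonneg _) (mul_le_one₀
        (pow_le_one₀ hr.1.le hr.2.le) (norm_nonneg _)
        ((norm_pow_le T n).trans (pow_le_one₀ (norm_nonneg _) hT)))
  exact fun x => ((ContinuousLinearMap.apply ℂ H x).continuous.tendsto _).comp key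

/-! ### Almost orthogonal systems -/

section Geometry

variable {H : Type*} [NormedAddCommGroup H] [InnerProductSpace ℂ H]

/-- Vectors that a contraction nearly preserves are nearly orthogonal to vectors that it nearly
annihilates. -/
theorem norm_inner_le_of_contraction [CompleteSpace H] {A : H →L[ℂ] H} (hA : ‖A‖ ≤ 1) {u v : H}
    {γ ρ : ℝ} (hγ : 0 ≤ γ) (hu : γ * ‖u‖ ≤ ‖A u‖) (hv : ‖A v‖ ≤ ρ * ‖v‖) :
    ‖inner ℂ u v‖ ≤ (√(1 - γ ^ 2) + ρ) * (‖u‖ * ‖v‖) := by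
  set w := ContinuousLinearMap.adjoint A (A u) with hw
  have hAu : ‖A u‖ ≤ ‖u‖ := by simpa using A.le_of_opNorm_le hA u
  have hwn : ‖w‖ ≤ ‖A u‖ := by
    have h : ‖ContinuousLinearMap.adjoint A‖ ≤ 1 := by
      rwa [LinearIsometryEquiv.norm_map]
    simpa using (ContinuousLinearMap.adjoint A).le_of_opNorm_le h (A u)
  have hre : RCLike.re (inner ℂ u w) = ‖A u‖ ^ 2 := by
    rw [hw, ContinuousLinearMap.adjoint_inner_right, inner_self_eq_norm_sq]
  have hd : ‖u - w‖ ^ 2 ≤ (1 - γ ^ 2) * ‖u‖ ^ 2 := by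
    rw [@norm_sub_sq ℂ, hre]
    have h1 := pow_le_pow_left₀ (norm_nonneg _) hwn 2
    have h2 := pow_le_pow_left₀ (by positivity) hu 2
    nlinarith
  have hd' : ‖u - w‖ ≤ √(1 - γ ^ 2) * ‖u‖ := by
    have := Real.sqrt_le_sqrt hd
    rwa [Real.sqrt_sq (norm_nonneg _), Real.sqrt_mul' _ (sq_nonneg _),
      Real.sqrt_sq (norm_nonneg _)] at this
  have hsplit : inner ℂ u v = inner ℂ (u - w) v + inner ℂ (A u) (A v) := by
    rw [inner_sub_left, hw, ContinuousLinearMap.adjoint_inner_left]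
    ring
  calc ‖inner ℂ u v‖ ≤ ‖u - w‖ * ‖v‖ + ‖A u‖ * ‖A v‖ := by
        rw [hsplit]
        exact (norm_add_le _ _).trans (add_le_add (norm_inner_le_norm _ _) (norm_inner_le_norm _ _))
    _ ≤ √(1 - γ ^ 2) * ‖u‖ * ‖v‖ + ‖u‖ * (ρ * ‖v‖) := by gcongr
    _ = _ := by ring

/-- A Gershgorin type lower bound for the Gram matrix. -/
theorem sum_sq_le_norm_sum_sq {N : ℕ} {e : Fin N → H} {s : ℝ} (hs : 0 ≤ s)
    (he : ∀ j k, j ≠ k → ‖inner ℂ (e j) (e k)‖ ≤ s * (‖e j‖ * ‖e k‖)) (c : Fin N → ℂ) :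
    (1 - ((N : ℝ) - 1) * s) * ∑ k, (‖c k‖ * ‖e k‖) ^ 2 ≤ ‖∑ k, c k • e k‖ ^ 2 := by
  set x : Fin N → ℝ := fun k => ‖c k‖ * ‖e k‖ with hx
  have hterm : ∀ j k, (if j = k then (1 + s) * x k ^ 2 else 0) - s * (x j * x k) ≤
      RCLike.re (inner ℂ (c j • e j) (c k • e k)) := by
    intro j k
    split_ifs with h
    · subst h
      rw [inner_self_eq_norm_sq, norm_smul]
      exact le_of_eq (by simp only [hx]; ring)
    · have h1 : ‖inner ℂ (c j • e j) (c k • e k)‖ ≤ s * (x j * x k) := by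
        rw [inner_smul_left, inner_smul_right, norm_mul, norm_mul, RCLike.norm_conj]
        calc ‖c j‖ * (‖c k‖ * ‖inner ℂ (e j) (e k)‖)
            ≤ ‖c j‖ * (‖c k‖ * (s * (‖e j‖ * ‖e k‖))) := by gcongr; exact he j k h
          _ = _ := by simp only [hx]; ring
      have h2 := (abs_le.1 (RCLike.abs_re_le_norm (inner ℂ (c j • e j) (c k • e k)))).1
      linarith
  have hsum : (1 + s) * ∑ k, x k ^ 2 - s * (∑ k, x k) ^ 2 ≤ ‖∑ k, c k • e k‖ ^ 2 := by
    rw [← @inner_self_eq_norm_sq ℂ, sum_inner, map_sum]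
    simp only [inner_sum, map_sum]
    calc (1 + s) * ∑ k, x k ^ 2 - s * (∑ k, x k) ^ 2
        = ∑ j, ∑ k, ((if j = k then (1 + s) * x k ^ 2 else 0) - s * (x j * x k)) := by
          simp only [Finset.sum_sub_distrib, Finset.sum_ite_eq, Finset.mem_univ, if_true,
            ← Finset.mul_sum, sq (∑ k, x k), Finset.sum_mul_sum]
      _ ≤ _ := Finset.sum_le_sum fun j _ => Finset.sum_le_sum fun k _ => hterm j k
  have hcs : (∑ k, x k) ^ 2 ≤ N * ∑ k, x k ^ 2 := by
    simpa using sq_sum_le_card_mul_sum_sq (s := Finset.univ) (f := x)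
  nlinarith [mul_le_mul_of_nonneg_left hcs hs]

theorem norm_sum_sq_le {N : ℕ} {e : Fin N → H} (he : ∀ k, ‖e k‖ ≤ 1) (c : Fin N → ℂ) :
    ‖∑ k, c k • e k‖ ^ 2 ≤ N * ∑ k, ‖c k‖ ^ 2 := by
  have h : ‖∑ k, c k • e k‖ ≤ ∑ k, ‖c k‖ :=
    (norm_sum_le _ _).trans (Finset.sum_le_sum fun k _ => by
      rw [norm_smul]; exact mul_le_of_le_one_right (norm_nonneg _) (he k))
  refine (pow_le_pow_left₀ (norm_nonneg _) h 2).trans ?_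
  simpa using sq_sum_le_card_mul_sum_sq (s := Finset.univ) (f := fun k => ‖c k‖)

end Geometry

/-! ### Numerical estimates -/

theorem norm_blaschkeFactor_le_eta_sq {N : ℕ} {a : Fin N → ℂ} (ha : ∀ k, ‖a k‖ < 1)
    (j k : Fin N) : ‖blaschkeFactor (a j) (a k)‖ ≤ eta a ^ 2 := by
  have h1 : √‖blaschkeFactor (a j) (a k)‖ / √(1 - max ‖a j‖ ‖a k‖ ^ 2) ≤ eta a :=
    le_ciSup (f := fun p : Fin N × Fin N =>
      √‖blaschkeFactor (a p.1) (a p.2)‖ / √(1 - max ‖a p.1‖ ‖a p.2‖ ^ 2))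
      (Set.finite_range _).bddAbove (j, k)
  have hm : max ‖a j‖ ‖a k‖ < 1 := max_lt (ha j) (ha k)
  have hm0 : 0 ≤ max ‖a j‖ ‖a k‖ := le_max_of_le_left (norm_nonneg _)
  have hpos : 0 < √(1 - max ‖a j‖ ‖a k‖ ^ 2) := Real.sqrt_pos.2 (by nlinarith)
  have hle : √(1 - max ‖a j‖ ‖a k‖ ^ 2) ≤ 1 := Real.sqrt_le_one.2 (by nlinarith)
  have h2 : √‖blaschkeFactor (a j) (a k)‖ ≤ eta a :=
    (le_div_self (Real.sqrt_nonneg _) hpos hle).trans h1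
  exact (Real.sqrt_le_left (by linarith [Real.sqrt_nonneg ‖blaschkeFactor (a j) (a k)‖])).1 h2

theorem eta_nonneg {N : ℕ} (a : Fin N → ℂ) : 0 ≤ eta a :=
  Real.iSup_nonneg fun _ => by positivity

/-- The summand `5√2 η` in the hypothesis on `‖ψ_N(T)‖` absorbs the error `η²` in the angles between
the basis vectors. -/
theorem sqrt_add_sq_le {β η : ℝ} (hβ : 0 ≤ β) (hη : 0 ≤ η) (h : β + 5 * √2 * η ≤ 1) :
    √(1 - (β + 5 * √2 * η) ^ 2) + η ^ 2 ≤ √(1 - β ^ 2) := by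
  have h2 : √2 ^ 2 = 2 := Real.sq_sqrt (by norm_num)
  have hδ : (5 * √2 * η) ^ 2 = 50 * η ^ 2 := by rw [mul_pow, mul_pow, h2]; ring
  have hδ0 : 0 ≤ 5 * √2 * η := by positivity
  set δ := 5 * √2 * η
  have hη1 : η ^ 2 ≤ 1 := by nlinarith
  have hs : η ^ 2 ≤ √(1 - β ^ 2) := Real.le_sqrt_of_sq_le (by nlinarith)
  have hs1 : √(1 - β ^ 2) ≤ 1 := Real.sqrt_le_one.2 (by nlinarith)
  have hss : √(1 - β ^ 2) ^ 2 = 1 - β ^ 2 := Real.sq_sqrt (by nlinarith)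
  rw [← le_sub_iff_add_le]
  refine (Real.sqrt_le_left (by linarith)).2 ?_
  nlinarith [mul_nonneg hβ hδ0, sq_nonneg (η ^ 2), sq_nonneg η]

theorem mul_sqrt_one_sub_sq_lt_one {N : ℕ} (hN : 2 ≤ N) {β : ℝ}
    (hβ : √(1 - 1 / ((N : ℝ) - 1) ^ 2) < β) : ((N : ℝ) - 1) * √(1 - β ^ 2) < 1 := by
  have hN' : (0 : ℝ) < (N : ℝ) - 1 := by
    have : (2 : ℝ) ≤ N := by exact_mod_cast hN
    linarith
  have hβ0 : 0 < β := (Real.sqrt_nonneg _).trans_lt hβ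
  have h1 : 1 - 1 / ((N : ℝ) - 1) ^ 2 < β ^ 2 := (Real.sqrt_lt' hβ0).1 hβ
  have h2 : √(1 - β ^ 2) < 1 / ((N : ℝ) - 1) := by
    rw [Real.sqrt_lt' (by positivity), div_pow, one_pow]
    linarith
  rwa [lt_div_iff₀ hN', mul_comm] at h2

/-! ### Cyclic operators annihilated by a polynomial -/

theorem finrank_le_of_aeval_eq_zero {H : Type*} [NormedAddCommGroup H] [InnerProductSpace ℂ H]
    [CompleteSpace H] {T : H →L[ℂ] H} (hmf : IsMultiplicityFree T) {p : Polynomial ℂ}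
    (hp : p.Monic) (h0 : Polynomial.aeval T p = 0) :
    FiniteDimensional ℂ H ∧ Module.finrank ℂ H ≤ p.natDegree := by
  obtain ⟨y, hy⟩ := hmf
  let v : Fin p.natDegree → H := fun i => (T ^ (i : ℕ)) y
  have hsub : Submodule.span ℂ (Set.range fun n : ℕ => (T ^ n) y) ≤
      Submodule.span ℂ (Set.range v) := by
    rw [Submodule.span_le]
    rintro _ ⟨n, rfl⟩
    have hmod : Polynomial.aeval T ((Polynomial.X : Polynomial ℂ) ^ n %ₘ p) = T ^ n := by
      rw [Polynomial.aeval_modByMonic_eq_self_of_root h0]; simp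
    by_cases hp1 : p = 1
    · have : (1 : H →L[ℂ] H) = 0 := by simpa [hp1] using h0
      have hz : (T ^ n) y = 0 := by
        rw [← one_mul (T ^ n), this]; simp
      simp [hz]
    · have hdeg := Polynomial.natDegree_modByMonic_lt (Polynomial.X ^ n) hp hp1
      simp only [SetLike.mem_coe]
      rw [← hmod, Polynomial.aeval_eq_sum_range' hdeg]
      rw [_root_.sum_apply]
      refine Submodule.sum_mem _ fun i hi => ?_
      rw [_root_.smul_apply]
      exact Submodule.smul_mem _ _
        (Submodule.subset_span ⟨⟨i, Finset.mem_range.1 hi⟩, rfl⟩)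
  have hfd : FiniteDimensional ℂ (Submodule.span ℂ (Set.range v)) :=
    FiniteDimensional.span_of_finite ℂ (Set.finite_range v)
  have htop : Submodule.span ℂ (Set.range v) = ⊤ := by
    rw [eq_top_iff, ← show _ = ⊤ from hy]
    exact Submodule.topologicalClosure_minimal _ hsub (Submodule.closed_of_finiteDimensional _)
  have hfd' : FiniteDimensional ℂ H := by
    rw [htop] at hfd
    exact Module.Finite.equiv (Submodule.topEquiv (R := ℂ) (M := H))
  refine ⟨hfd', ?_⟩
  have := finrank_range_le_card (R := ℂ) v
  rw [Set.finrank, htop, finrank_top] at this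
  simpa using this

/-! ### Orbits under commuting contractions -/

section Orbit

variable {H : Type*} [NormedAddCommGroup H] [InnerProductSpace ℂ H]
  {R : Type*} [CommMonoid R] (φ : R →* (H →L[ℂ] H)) {b : ℕ → R}

theorem norm_map_prod_le (hb : ∀ i, ‖φ (b i)‖ ≤ 1) (s : Finset ℕ) :
    ‖φ (∏ i ∈ s, b i)‖ ≤ 1 := by
  classical
  induction s using Finset.induction_on with
  | empty => rw [Finset.prod_empty, map_one]; exact ContinuousLinearMap.norm_id_le
  | insert i s hi ih =>
    rw [Finset.prod_insert hi, map_mul]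
    exact (norm_mul_le _ _).trans (mul_le_one₀ (hb i) (norm_nonneg _) ih)

theorem norm_map_prod_range_le_of_le (hb : ∀ i, ‖φ (b i)‖ ≤ 1) {n k : ℕ} (hk : k ≤ n) (x : H) :
    ‖φ (∏ i ∈ Finset.range n, b i) x‖ ≤ ‖φ (∏ i ∈ Finset.range k, b i) x‖ := by
  rw [← Finset.prod_range_mul_prod_Ico b hk, mul_comm, map_mul, mul_apply_eq_comp]
  simpa using (φ (∏ i ∈ Finset.Ico k n, b i)).le_of_opNorm_le (norm_map_prod_le φ hb _) _

/-- The partial products `b₀ ⋯ b_{k-1} x` form an almost orthogonal system if `b₀ ⋯ b_{n-1} x` is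
long, `b₀ ⋯ bₙ = 0`, and every `b_j` is small on the kernel of `bₙ`.  For `j < k` the contraction
`b_j ⋯ b_{n-1}` nearly preserves the `j`-th vector; it sends the `k`-th one into the image under
`b_j` of the kernel of `bₙ`. -/
theorem norm_inner_map_prod_range_le [CompleteSpace H] (hb : ∀ i, ‖φ (b i)‖ ≤ 1) {n : ℕ}
    (h0 : φ (∏ i ∈ Finset.range (n + 1), b i) = 0) {x : H} (hx : ‖x‖ ≤ 1) {γ ρ : ℝ} (hγ : 0 ≤ γ)
    (hxγ : γ ≤ ‖φ (∏ i ∈ Finset.range n, b i) x‖)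
    (hρ : ∀ j < n, ∀ y, φ (b n) y = 0 → ‖φ (b j) y‖ ≤ ρ * ‖y‖) (hρ0 : 0 ≤ ρ)
    {j k : ℕ} (hjk : j < k) (hk : k ≤ n) :
    ‖inner ℂ (φ (∏ i ∈ Finset.range j, b i) x) (φ (∏ i ∈ Finset.range k, b i) x)‖ ≤
      (√(1 - γ ^ 2) + ρ) *
        (‖φ (∏ i ∈ Finset.range j, b i) x‖ * ‖φ (∏ i ∈ Finset.range k, b i) x‖) := by
  have hjn : j < n := hjk.trans_le hk
  set v := φ (∏ i ∈ Finset.range k, b i) x with hv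
  refine norm_inner_le_of_contraction (A := φ (∏ i ∈ Finset.Ico j n, b i))
    (norm_map_prod_le φ hb _) hγ ?_ ?_
  · rw [← mul_apply_eq_comp, ← map_mul, mul_comm (∏ i ∈ _, b i),
      Finset.prod_range_mul_prod_Ico b hjn.le]
    have hj1 : ‖φ (∏ i ∈ Finset.range j, b i) x‖ ≤ 1 := by
      simpa using (φ (∏ i ∈ Finset.range j, b i)).le_of_opNorm_le_of_le
        (norm_map_prod_le φ hb _) hx
    exact (mul_le_of_le_one_right hγ hj1).trans hxγ
  -- Here `bₙ y = 0`, because `k > j` makes `b₀ ⋯ bₙ` a factor of `b_{j+1} ⋯ bₙ · b₀ ⋯ b_{k-1}`.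
  · set y := φ (∏ i ∈ Finset.Ico (j + 1) n, b i) v with hy
    have hy1 : ‖y‖ ≤ ‖v‖ := by
      simpa using (φ (∏ i ∈ Finset.Ico (j + 1) n, b i)).le_of_opNorm_le (norm_map_prod_le φ hb _) v
    have hyn : φ (b n) y = 0 := by
      obtain ⟨c, hc⟩ : (∏ i ∈ Finset.range (n + 1), b i) ∣
          b n * (∏ i ∈ Finset.Ico (j + 1) n, b i) * ∏ i ∈ Finset.range k, b i := by
        rw [mul_comm (b n), ← Finset.prod_Ico_succ_top hjn,
          ← Finset.prod_range_mul_prod_Ico b (by omega : j + 1 ≤ n + 1), mul_comm]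
        exact mul_dvd_mul_left _ (Finset.prod_dvd_prod_of_subset _ _ _
          (Finset.range_subset_range.2 hjk))
      rw [hy, hv, ← mul_apply_eq_comp, ← mul_apply_eq_comp, ← map_mul,
        ← map_mul, hc, map_mul, h0, zero_mul, _root_.zero_apply]
    rw [Finset.prod_eq_prod_Ico_succ_bot hjn, map_mul, mul_apply_eq_comp]
    exact (hρ j hjn y hyn).trans (mul_le_mul_of_nonneg_left hy1 hρ0)

end Orbit

/-! ### Blaschke factors of a contraction -/

section Blaschke

variable {H : Type*} [NormedAddCommGroup H] [InnerProductSpace ℂ H] [CompleteSpace H]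
  [Nontrivial H] {T : H →L[ℂ] H} (hT : ‖T‖ ≤ 1) {a : ℂ} (ha : ‖a‖ < 1)

theorem wienerEval_wienerBlaschke_sub (x : H) :
    wienerEval T hT (wienerBlaschke a ha) x -
        (starRingEnd ℂ) a • T (wienerEval T hT (wienerBlaschke a ha) x) = T x - a • x := by
  have h := congrArg (wienerEval T hT) (one_sub_mul_wienerBlaschke a ha)
  simp only [map_mul, map_sub, map_one, wienerEval_X, AlgHom.commutes] at h
  simpa [Algebra.algebraMap_eq_smul_one] using DFunLike.congr_fun h x

/-- The Blaschke factors of a contraction are contractions, since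
`‖(1 - conj a T) y‖² - ‖(T - a) y‖² = (1 - |a|²) (‖y‖² - ‖T y‖²)`. -/
theorem norm_wienerEval_wienerBlaschke_le : ‖wienerEval T hT (wienerBlaschke a ha)‖ ≤ 1 := by
  refine ContinuousLinearMap.opNorm_le_bound _ zero_le_one fun x => ?_
  have hg := congrArg (wienerEval T hT)
    (one_sub_mul_wienerGeom ((starRingEnd ℂ) a) (by rwa [RCLike.norm_conj]))
  simp only [map_mul, map_sub, map_one, wienerEval_X, AlgHom.commutes] at hg
  set y := wienerEval T hT (wienerGeom ((starRingEnd ℂ) a) (by rwa [RCLike.norm_conj])) x with hy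
  have hx : x = y - (starRingEnd ℂ) a • T y := by
    simpa [Algebra.algebraMap_eq_smul_one] using (DFunLike.congr_fun hg x).symm
  have hbx : wienerEval T hT (wienerBlaschke a ha) x = T y - a • y := by
    rw [wienerBlaschke, map_mul, mul_apply_eq_comp, ← hy, map_sub, wienerEval_X,
      AlgHom.commutes]
    simp [Algebra.algebraMap_eq_smul_one]
  have hTy : ‖T y‖ ≤ ‖y‖ := by simpa using T.le_of_opNorm_le hT y
  have hre : RCLike.re (inner ℂ (T y) (a • y)) =
      RCLike.re (inner ℂ y ((starRingEnd ℂ) a • T y)) := by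
    rw [inner_smul_right, inner_smul_right, ← inner_conj_symm (T y) y]
    generalize inner ℂ y (T y) = w
    simp
  have hxn : ‖x‖ = ‖y - (starRingEnd ℂ) a • T y‖ := congrArg norm hx
  rw [one_mul, hbx, hxn]
  refine (sq_le_sq₀ (norm_nonneg _) (norm_nonneg _)).1 ?_
  rw [@norm_sub_sq ℂ, @norm_sub_sq ℂ, hre, norm_smul, norm_smul, RCLike.norm_conj]
  nlinarith [mul_nonneg (by nlinarith [norm_nonneg a] : 0 ≤ 1 - ‖a‖ ^ 2)
    (by nlinarith [norm_nonneg (T y)] : 0 ≤ ‖y‖ ^ 2 - ‖T y‖ ^ 2)]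

/-- A Blaschke factor of `T` acts on an eigenvector through its value at the eigenvalue. -/
theorem norm_wienerEval_wienerBlaschke_apply_of_eigenvector {c : ℂ} (hc : ‖c‖ < 1) {y : H}
    (hy : wienerEval T hT (wienerBlaschke c hc) y = 0) :
    ‖wienerEval T hT (wienerBlaschke a ha) y‖ = ‖blaschkeFactor a c‖ * ‖y‖ := by
  have hTy : T y = c • y := by
    have := wienerEval_wienerBlaschke_sub hT hc y
    rw [hy, map_zero, smul_zero, sub_zero] at this
    exact sub_eq_zero.1 this.symm
  have hcomm : T (wienerEval T hT (wienerBlaschke a ha) y) =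
      c • wienerEval T hT (wienerBlaschke a ha) y := by
    have h := congrArg (wienerEval T hT) (mul_comm wienerX (wienerBlaschke a ha))
    simp only [map_mul, wienerEval_X] at h
    have h' := DFunLike.congr_fun h y
    simpa [hTy] using h'
  have h := wienerEval_wienerBlaschke_sub hT ha y
  rw [hcomm, hTy, smul_smul, ← sub_smul] at h
  nth_rewrite 1 [← one_smul ℂ (wienerEval T hT (wienerBlaschke a ha) y)] at h
  rw [← sub_smul] at h
  have hne := one_sub_conj_mul_ne_zero ha hc.le
  have h2 : wienerEval T hT (wienerBlaschke a ha) y = blaschkeFactor a c • y := by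
    rw [blaschkeFactor, div_eq_inv_mul, mul_smul, ← h, smul_smul, inv_mul_cancel₀ hne, one_smul]
  rw [h2, norm_smul]

end Blaschke

/-! ### The almost orthogonal basis of a multiplicity-free operator -/

/-- The Blaschke factors of a finite family, indexed by `ℕ` and equal to `1` outside the family. -/
noncomputable def wienerFactor {N : ℕ} (a : Fin N → ℂ) (ha : ∀ k, ‖a k‖ < 1) (i : ℕ) :
    wienerAlgebra :=
  if h : i < N then wienerBlaschke (a ⟨i, h⟩) (ha _) else 1

section

variable {N : ℕ} {a : Fin N → ℂ}

theorem wienerFactor_val (ha : ∀ k, ‖a k‖ < 1) (k : Fin N) :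
    wienerFactor a ha k = wienerBlaschke (a k) (ha k) := by
  simp [wienerFactor]

theorem blaschkeProduct_eq_wienerEval (ha : ∀ k, ‖a k‖ < 1) {z : ℂ} (hz : ‖z‖ < 1) :
    blaschkeProduct a z = wienerEval z hz.le (∏ i ∈ Finset.range N, wienerFactor a ha i) := by
  rw [Finset.prod_range, map_prod]
  exact Finset.prod_congr rfl fun k _ => by
    rw [wienerFactor_val, wienerEval_wienerBlaschke]

theorem blaschkeQuotient_last_eq_wienerEval (ha : ∀ k, ‖a k‖ < 1) (hN : N - 1 < N)
    {z : ℂ} (hz : ‖z‖ < 1) :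
    blaschkeQuotient a ⟨N - 1, hN⟩ z =
      wienerEval z hz.le (∏ i ∈ Finset.range (N - 1), wienerFactor a ha i) := by
  rw [map_prod, blaschkeQuotient]
  refine Finset.prod_nbij (fun k => (k : ℕ)) ?_ (Fin.val_injective.injOn) ?_ ?_
  · intro k hk
    have h1 : (k : ℕ) ≠ N - 1 := fun h => (Finset.mem_erase.1 hk).1 (Fin.ext h)
    have h2 := k.2
    exact Finset.mem_range.2 (by omega)
  · intro i hi
    have hi' : i < N - 1 := by simpa using hi
    exact ⟨⟨i, by omega⟩, by simp [Fin.ext_iff, hi'.ne], rfl⟩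
  · intro k _
    rw [wienerFactor_val, wienerEval_wienerBlaschke]

theorem isHInfty_one : IsHInfty fun _ => 1 :=
  ⟨differentiableOn_const _, 1, fun _ _ => by simp⟩

variable {H : Type*} [NormedAddCommGroup H] [InnerProductSpace ℂ H] [CompleteSpace H]
  {T : H →L[ℂ] H}

theorem wienerEval_prod_eq_zero (ha : ∀ k, ‖a k‖ < 1) [Nontrivial H] (hT : ‖T‖ ≤ 1)
    (hθ : IsMinimalFunction T (blaschkeProduct a)) :
    wienerEval T hT (∏ i ∈ Finset.range N, wienerFactor a ha i) = 0 :=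
  (isFunctionalCalculusValue_wienerEval hT fun _ hz => blaschkeProduct_eq_wienerEval ha hz).unique
    ((hθ.2 _ hθ.1.1).2 ⟨_, isHInfty_one, fun _ _ => (mul_one _).symm⟩)

theorem finrank_le_of_wienerEval_prod_eq_zero (ha : ∀ k, ‖a k‖ < 1) [Nontrivial H] (hT : ‖T‖ ≤ 1)
    (hmf : IsMultiplicityFree T)
    (h0 : wienerEval T hT (∏ i ∈ Finset.range N, wienerFactor a ha i) = 0) :
    FiniteDimensional ℂ H ∧ Module.finrank ℂ H ≤ N := by
  have hmonic : (∏ k, (Polynomial.X - Polynomial.C (a k))).Monic :=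
    Polynomial.monic_prod_of_monic _ _ fun k _ => Polynomial.monic_X_sub_C _
  have hdeg : (∏ k, (Polynomial.X - Polynomial.C (a k))).natDegree = N := by
    simp [Polynomial.natDegree_prod_of_monic, Polynomial.monic_X_sub_C]
  have hzero : Polynomial.aeval T (∏ k, (Polynomial.X - Polynomial.C (a k))) = 0 := by
    have h1 : Polynomial.aeval T (∏ k, (Polynomial.X - Polynomial.C (a k))) =
        wienerEval T hT (∏ k, (wienerX - algebraMap ℂ _ (a k))) := by
      have : (∏ k, (wienerX - algebraMap ℂ wienerAlgebra (a k))) =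
          Polynomial.aeval wienerX (∏ k, (Polynomial.X - Polynomial.C (a k))) := by
        simp [map_prod]
      rw [this, ← Polynomial.aeval_algHom_apply, wienerEval_X]
    rw [h1]
    simp only [← one_sub_mul_wienerBlaschke _ (ha _), ← wienerFactor_val ha,
      Finset.prod_mul_distrib]
    rw [map_mul, ← Finset.prod_range (wienerFactor a ha), h0, mul_zero]
  have := finrank_le_of_aeval_eq_zero hmf hmonic hzero
  rwa [hdeg] at this

/-- A multiplicity-free operator with minimal function `b_{a_1} ⋯ b_{a_N}` has a basis which it
transforms by a rule depending on the `a_k` only, and whose Gram matrix is controlled by the norm of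
`ψ_N(T)`. -/
theorem exists_almost_orthogonal_basis (ha : ∀ k, ‖a k‖ < 1) (hN : 2 ≤ N)
    (hN1 : N - 1 < N) (hT : ‖T‖ ≤ 1) (hmf : IsMultiplicityFree T)
    (hθ : IsMinimalFunction T (blaschkeProduct a)) {β : ℝ}
    (hβ : √(1 - 1 / ((N : ℝ) - 1) ^ 2) < β)
    (hψ : ‖functionalCalculus T (blaschkeQuotient a ⟨N - 1, hN1⟩)‖ > β + 5 * √2 * eta a) :
    ∃ (v : ℕ → H) (B : Module.Basis (Fin N) ℂ H), FiniteDimensional ℂ H ∧ (∀ k, B k = v k) ∧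
      v N = 0 ∧
      (∀ k : Fin N, v (k + 1) - (starRingEnd ℂ) (a k) • T (v (k + 1)) = T (v k) - a k • v k) ∧
      (∀ k, ‖B k‖ ≤ 1) ∧
      ∀ c : Fin N → ℂ, β ^ 2 * (1 - ((N : ℝ) - 1) * √(1 - β ^ 2)) * ∑ k, ‖c k‖ ^ 2 ≤
        ‖∑ k, c k • B k‖ ^ 2 := by
  have hβ0 : 0 < β := (Real.sqrt_nonneg _).trans_lt hβ
  have hη := eta_nonneg a
  have hδ : 0 ≤ 5 * √2 * eta a := by positivity
  have hγ0 : 0 ≤ β + 5 * √2 * eta a := by linarith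
  have hnt : Nontrivial H := by
    by_contra h
    rw [not_nontrivial_iff_subsingleton] at h
    have : functionalCalculus T (blaschkeQuotient a ⟨N - 1, hN1⟩) = 0 :=
      Subsingleton.elim _ _
    rw [this, norm_zero] at hψ
    linarith
  obtain ⟨n, rfl⟩ : ∃ n, N = n + 1 := ⟨N - 1, by omega⟩
  set φ : wienerAlgebra →* (H →L[ℂ] H) := (wienerEval T hT : wienerAlgebra →* (H →L[ℂ] H))
  have hφa : ∀ p, φ p = wienerEval T hT p := fun _ => rfl
  set b := wienerFactor a ha
  have hb : ∀ i, ‖φ (b i)‖ ≤ 1 := by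
    intro i
    simp only [b, wienerFactor]
    split_ifs
    · exact norm_wienerEval_wienerBlaschke_le hT _
    · rw [map_one, norm_one]
  have h0 : φ (∏ i ∈ Finset.range (n + 1), b i) = 0 := wienerEval_prod_eq_zero ha hT hθ
  rw [(isFunctionalCalculusValue_wienerEval hT fun _ hz =>
    blaschkeQuotient_last_eq_wienerEval ha hN1 hz).functionalCalculus_eq] at hψ
  obtain ⟨x, hx1, hx⟩ := ContinuousLinearMap.exists_lt_apply_of_lt_opNorm _ hψ
  rw [Nat.add_sub_cancel] at hx
  change _ < ‖φ (∏ i ∈ Finset.range n, b i) x‖ at hx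
  set v : ℕ → H := fun k => φ (∏ i ∈ Finset.range k, b i) x with hv
  have hv1 : ∀ k, ‖v k‖ ≤ 1 := fun k => by
    simpa using (φ (∏ i ∈ Finset.range k, b i)).le_of_opNorm_le_of_le
      (norm_map_prod_le φ hb _) hx1.le
  have hγ1 : β + 5 * √2 * eta a ≤ 1 := hx.le.trans (hv1 n)
  have hvβ : ∀ k : Fin (n + 1), β ≤ ‖v k‖ := fun k =>
    (by linarith : β ≤ β + 5 * √2 * eta a).trans
      (hx.le.trans (norm_map_prod_range_le_of_le φ hb (Nat.le_of_lt_succ k.2) x))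
  have hρ : ∀ j < n, ∀ y, φ (b n) y = 0 → ‖φ (b j) y‖ ≤ eta a ^ 2 * ‖y‖ := by
    intro j hj y hy
    have hn' : b n = _ := wienerFactor_val ha (Fin.last n)
    have hj' : b j = _ := wienerFactor_val ha ⟨j, hj.trans n.lt_succ_self⟩
    rw [hn', hφa] at hy
    rw [hj', hφa, norm_wienerEval_wienerBlaschke_apply_of_eigenvector hT _ _ hy]
    exact mul_le_mul_of_nonneg_right (norm_blaschkeFactor_le_eta_sq ha _ _) (norm_nonneg _)
  have hlt : ∀ j k : Fin (n + 1), j < k →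
      ‖inner ℂ (v j) (v k)‖ ≤ √(1 - β ^ 2) * (‖v j‖ * ‖v k‖) := fun j k hjk =>
    (norm_inner_map_prod_range_le φ hb h0 hx1.le hγ0 hx.le hρ (sq_nonneg _) hjk
      (Nat.le_of_lt_succ k.2)).trans
      (mul_le_mul_of_nonneg_right (sqrt_add_sq_le hβ0.le hη hγ1) (by positivity))
  have hne : ∀ j k : Fin (n + 1), j ≠ k →
      ‖inner ℂ (v j) (v k)‖ ≤ √(1 - β ^ 2) * (‖v j‖ * ‖v k‖) := by
    intro j k hjk
    rcases lt_or_gt_of_ne hjk with h | h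
    · exact hlt j k h
    · rw [norm_inner_symm, mul_comm ‖v j‖]
      exact hlt k j h
  have hs : 0 < 1 - (((n + 1 : ℕ) : ℝ) - 1) * √(1 - β ^ 2) :=
    sub_pos.2 (mul_sqrt_one_sub_sq_lt_one hN hβ)
  have hgram : ∀ c : Fin (n + 1) → ℂ,
      β ^ 2 * (1 - (((n + 1 : ℕ) : ℝ) - 1) * √(1 - β ^ 2)) * ∑ k, ‖c k‖ ^ 2 ≤
        ‖∑ k, c k • v k‖ ^ 2 := by
    intro c
    refine le_trans ?_ (sum_sq_le_norm_sum_sq (e := fun k : Fin (n + 1) => v k)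
      (Real.sqrt_nonneg _) hne c)
    rw [mul_comm (β ^ 2), mul_assoc, Finset.mul_sum]
    refine mul_le_mul_of_nonneg_left (Finset.sum_le_sum fun k _ => ?_) hs.le
    rw [mul_pow, mul_comm (β ^ 2)]
    gcongr
    exact hvβ k
  have hli : LinearIndependent ℂ fun k : Fin (n + 1) => v k := by
    rw [Fintype.linearIndependent_iff]
    intro c hc i
    have h := hgram c
    rw [hc, norm_zero, zero_pow two_ne_zero] at h
    have hsum : ∑ k, ‖c k‖ ^ 2 ≤ 0 := nonpos_of_mul_nonpos_right h (by positivity)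
    have hi := Finset.single_le_sum (f := fun k => ‖c k‖ ^ 2) (fun k _ => sq_nonneg _)
      (Finset.mem_univ i)
    have : ‖c i‖ ^ 2 ≤ 0 := hi.trans hsum
    exact norm_eq_zero.1 (pow_eq_zero_iff two_ne_zero |>.1 (le_antisymm this (sq_nonneg _)))
  obtain ⟨hfd, hfr⟩ := finrank_le_of_wienerEval_prod_eq_zero ha hT hmf h0
  have hcard : Fintype.card (Fin (n + 1)) = Module.finrank ℂ H :=
    le_antisymm hli.fintype_card_le_finrank (by simpa using hfr)
  have hB : ∀ k, basisOfLinearIndependentOfCardEqFinrank hli hcard k = v k := fun k => by simp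
  refine ⟨v, basisOfLinearIndependentOfCardEqFinrank hli hcard, hfd, hB, ?_, ?_, ?_, ?_⟩
  · simp only [hv, h0, _root_.zero_apply]
  · intro k
    have h : v (k + 1) = wienerEval T hT (wienerBlaschke (a k) (ha k)) (v k) := by
      simp only [hv]
      rw [Finset.prod_range_succ, mul_comm, map_mul, mul_apply_eq_comp]
      exact congrArg (fun p => φ p _) (wienerFactor_val ha k)
    rw [h]
    exact wienerEval_wienerBlaschke_sub hT (ha k) (v k)
  · intro k
    rw [hB]
    exact hv1 k
  · simpa only [hB] using hgram

end

/-! ### Comparing two bases -/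

theorem boundFactor_pos {N : ℕ} (hN : 2 ≤ N) {β : ℝ} (hβ : √(1 - 1 / ((N : ℝ) - 1) ^ 2) < β) :
    0 < boundFactor β N := by
  have hβ0 : 0 < β := (Real.sqrt_nonneg _).trans_lt hβ
  have hs := sub_pos.2 (mul_sqrt_one_sub_sq_lt_one hN hβ)
  have hN0 : (0 : ℝ) < N := by exact_mod_cast (by omega : 0 < N)
  exact inv_pos.2 (Real.sqrt_pos.2 (by positivity))

theorem norm_basis_equiv_le {H₁ H₂ : Type*} [NormedAddCommGroup H₁] [InnerProductSpace ℂ H₁]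
    [NormedAddCommGroup H₂] [InnerProductSpace ℂ H₂] {N : ℕ} (hN : 2 ≤ N) {β : ℝ}
    (hβ : √(1 - 1 / ((N : ℝ) - 1) ^ 2) < β) (B₁ : Module.Basis (Fin N) ℂ H₁)
    (B₂ : Module.Basis (Fin N) ℂ H₂)
    (h₁ : ∀ c : Fin N → ℂ, β ^ 2 * (1 - ((N : ℝ) - 1) * √(1 - β ^ 2)) * ∑ k, ‖c k‖ ^ 2 ≤
      ‖∑ k, c k • B₁ k‖ ^ 2)
    (h₂ : ∀ k, ‖B₂ k‖ ≤ 1) (X : H₁ →L[ℂ] H₂) (hX : ∀ k, X (B₁ k) = B₂ k) :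
    ‖X‖ ≤ boundFactor β N := by
  have hβ0 : 0 < β := (Real.sqrt_nonneg _).trans_lt hβ
  have hs := sub_pos.2 (mul_sqrt_one_sub_sq_lt_one hN hβ)
  have hN0 : (0 : ℝ) < N := by exact_mod_cast (by omega : 0 < N)
  set D := β ^ 2 / N * (1 - ((N : ℝ) - 1) * √(1 - β ^ 2)) with hD
  have hD0 : 0 < D := by positivity
  refine ContinuousLinearMap.opNorm_le_bound _ (boundFactor_pos hN hβ).le fun x => ?_
  have hx := h₁ (B₁.repr x)
  have hXx := norm_sum_sq_le h₂ (B₁.repr x)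
  have hXe : X x = ∑ k, B₁.repr x k • B₂ k := by
    conv_lhs => rw [← B₁.sum_repr x]
    rw [map_sum]
    exact Finset.sum_congr rfl fun k _ => by rw [map_smul, hX]
  rw [B₁.sum_repr] at hx
  rw [← hXe] at hXx
  have hkey : D * ‖X x‖ ^ 2 ≤ ‖x‖ ^ 2 :=
    calc D * ‖X x‖ ^ 2 ≤ D * (N * ∑ k, ‖B₁.repr x k‖ ^ 2) := by gcongr
      _ = β ^ 2 * (1 - ((N : ℝ) - 1) * √(1 - β ^ 2)) * ∑ k, ‖B₁.repr x k‖ ^ 2 := by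
        rw [hD]; field_simp
      _ ≤ _ := hx
  have hsq := Real.sqrt_le_sqrt hkey
  rw [Real.sqrt_mul hD0.le, Real.sqrt_sq (norm_nonneg _), Real.sqrt_sq (norm_nonneg _)] at hsq
  rw [boundFactor, ← hD, inv_mul_eq_div, le_div_iff₀ (Real.sqrt_pos.2 hD0), mul_comm]
  exact hsq

end ClassC0

theorem theorem3p5
    {H₁ : Type*} [NormedAddCommGroup H₁] [InnerProductSpace ℂ H₁] [CompleteSpace H₁]
    {H₂ : Type*} [NormedAddCommGroup H₂] [InnerProductSpace ℂ H₂] [CompleteSpace H₂]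
    (N : ℕ) (hN : 2 ≤ N) (a : Fin N → ℂ) (ha : ∀ k, ‖a k‖ < 1)
    (T₁ : H₁ →L[ℂ] H₁) (T₂ : H₂ →L[ℂ] H₂)
    (hT₁ : ClassC0.IsClassC0 T₁) (hT₂ : ClassC0.IsClassC0 T₂)
    (hmf₁ : ClassC0.IsMultiplicityFree T₁) (hmf₂ : ClassC0.IsMultiplicityFree T₂)
    (hθ₁ : ClassC0.IsMinimalFunction T₁ (ClassC0.blaschkeProduct a))
    (hθ₂ : ClassC0.IsMinimalFunction T₂ (ClassC0.blaschkeProduct a))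
    (β₁ β₂ : ℝ)
    (hβ₁ : √(1 - 1 / ((N : ℝ) - 1) ^ 2) < β₁) (hβ₁' : β₁ < 1)
    (hβ₂ : √(1 - 1 / ((N : ℝ) - 1) ^ 2) < β₂) (hβ₂' : β₂ < 1)
    (hψ₁ : ‖ClassC0.functionalCalculus T₁
        (ClassC0.blaschkeQuotient a ⟨N - 1, by omega⟩)‖ > β₁ + 5 * √2 * ClassC0.eta a)
    (hψ₂ : ‖ClassC0.functionalCalculus T₂
        (ClassC0.blaschkeQuotient a ⟨N - 1, by omega⟩)‖ > β₂ + 5 * √2 * ClassC0.eta a) :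
    0 < ClassC0.similarityConstant β₁ β₂ N ∧
      ∃ X : H₁ ≃L[ℂ] H₂, (∀ x : H₁, X (T₁ x) = T₂ (X x)) ∧
        max ‖(X : H₁ →L[ℂ] H₂)‖ ‖(X.symm : H₂ →L[ℂ] H₁)‖ ≤
          ClassC0.similarityConstant β₁ β₂ N := by
  refine ⟨lt_max_of_lt_left (ClassC0.boundFactor_pos hN hβ₁), ?_⟩
  obtain ⟨v, B₁, hfd₁, hv, hvN, hvT, hv1, hgram₁⟩ :=
    ClassC0.exists_almost_orthogonal_basis ha hN (by omega) hT₁.1 hmf₁ hθ₁ hβ₁ hψ₁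
  obtain ⟨w, B₂, hfd₂, hw, hwN, hwT, hw1, hgram₂⟩ :=
    ClassC0.exists_almost_orthogonal_basis ha hN (by omega) hT₂.1 hmf₂ hθ₂ hβ₂ hψ₂
  set X : H₁ ≃L[ℂ] H₂ := (B₁.equiv B₂ (Equiv.refl _)).toContinuousLinearEquiv with hX
  have hXB : ∀ k, X (B₁ k) = B₂ k := fun k => by simp [hX]
  have hXv : ∀ k ≤ N, X (v k) = w k := by
    intro k hk
    rcases hk.lt_or_eq with h | rfl
    · simpa [hv, hw] using hXB ⟨k, h⟩
    · rw [hvN, hwN, map_zero]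
  -- The transformation rule expresses `T` at `v k` through `T` at `v (k + 1)`, so that the
  -- intertwining relation propagates downwards from `v N = 0`.
  have hXT : ∀ k ≤ N, X (T₁ (v k)) = T₂ (w k) := by
    intro k hk
    induction hk using Nat.decreasingInduction with
    | self => simp [hvN, hwN]
    | of_succ k hk ih =>
      have h₁ : T₁ (v k) = a ⟨k, hk⟩ • v k +
          (v (k + 1) - (starRingEnd ℂ) (a ⟨k, hk⟩) • T₁ (v (k + 1))) := by
        rw [hvT ⟨k, hk⟩]; abel
      have h₂ : T₂ (w k) = a ⟨k, hk⟩ • w k +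
          (w (k + 1) - (starRingEnd ℂ) (a ⟨k, hk⟩) • T₂ (w (k + 1))) := by
        rw [hwT ⟨k, hk⟩]; abel
      rw [h₁, h₂, map_add, map_sub, map_smul, map_smul, ih, hXv k hk.le, hXv (k + 1) hk]
  refine ⟨X, fun x => ?_, max_le_max ?_ ?_⟩
  · have hlin : (X : H₁ →ₗ[ℂ] H₂) ∘ₗ (T₁ : H₁ →ₗ[ℂ] H₁) =
        (T₂ : H₂ →ₗ[ℂ] H₂) ∘ₗ (X : H₁ →ₗ[ℂ] H₂) :=
      B₁.ext fun k => by
        have h := hXT k k.2.le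
        rw [← hv, ← hw, ← hXB] at h
        simpa using h
    exact DFunLike.congr_fun hlin x
  · exact ClassC0.norm_basis_equiv_le hN hβ₁ B₁ B₂ hgram₁ hw1 X hXB
  · exact ClassC0.norm_basis_equiv_le hN hβ₂ B₂ B₁ hgram₂ hv1 X.symm
      fun k => by rw [← hXB]; simp
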